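/- Let $n\ge 2$, let $K$ be a field (for instance $\mathbb R$ or $\mathbb C$), let $p_1,\dots,p_n$ be vectors in a $K$-vector space with a symmetric bilinear form $\,\cdot\,$, satisfying $p_i\cdot p_i=0$ and $\sum_i p_i=0$, let $z_1,\dots,z_n\in K$ be pairwise distinct and let $\alpha'\in K$ be nonzero. Write $z_{ij}=z_i-z_j$, $s_{ij}=2p_i\cdot p_j$, $s_{i|J}=2p_i\cdot\sum_{j\in J}p_j$, and $\mathrm{PT}(l_1,\dots,l_k)=1/(z_{l_1l_2}z_{l_2l_3}\cdots z_{l_kl_1})$. Let $\alpha$ be an ordered list of distinct labels in $\{2,\dots,n-1\}$ (the colored scalars are ordered as $(1,\alpha,n)$), and let $i_1,\dots,i_m$ be the remaining labels in $\{2,\dots,n-1\}$ (the pions). Treat $2e_i\cdot e_j=2e_j\cdot e_i$ and $2e_i\cdot p_j$ ($i\neq j$) as independent variables. Let $$A_{ij}=\frac{s_{ij}}{z_{ij}},\qquad B_{ij}=\frac{2e_i\cdot e_j}{z_{ij}},\qquad C_{ij}=\frac{2e_i\cdot p_j}{z_{ij}}\quad(i\ne j),\qquad A_{ii}=B_{ii}=0,\qquad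 C_{ii}=-\sum_{k\ne i}\frac{2e_i\cdot p_k}{z_{ik}},$$ $\Psi=\begin{pmatrix}A&-C^{T}\\ C&B\end{pmatrix}$, and define the open-superstring gluon correlator $$\varphi^{\rm gauge}_n=\frac1{z_{1n}}\sum_{\rho}(-\alpha')^{-|\rho|}\prod_{(ij)\in\rho}\frac{2e_i\cdot e_j}{z_{ij}^2}\ \mathrm{Pf}\,\Psi^{\rho}_{1,n},$$ where $\rho$ runs over all sets of disjoint pairs of labels in $\{2,\dots,n-1\}$, and $\Psi^\rho_{1,n}$ is $\Psi$ with the rows and columns $1,n$ and $i,j,n+i,n+j$, for every $(ij)\in\rho$, removed. With $\alpha_0=1$ and $\partial_{2e_a\cdot(p_b-p_c)}=\partial_{2e_a\cdot p_b}-\partial_{2e_a\cdot p_c}$, let $$\varphi^{\rm gauge+color}_n=\partial_{2e_1\cdot e_n}\prod_{i=1}^{|\alpha|}\partial_{2e_{\alpha_i}\cdot(p_{\alpha_{i-1}}-p_n)}\,\varphi^{\rm gauge}_n ,$$ and let the mixed correlator $\varphi^{\rm scalar+color}_n(\{i_1,\dots,i_m\}|1,\alpha,n)$ be obtained from it by the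 dimensional reduction $e_a\cdot e_b\to 0$, $e_a\cdot p_b\to p_a\cdot p_b$. Put $$L=\sum_{\sigma\in\mathrm{Perm}(i_1,\dots,i_m)}\ \sum_{\rho\in\alpha\sqcup\!\sqcup\,\sigma}\ \prod_{a=1}^m s_{i_a|1\rho_{:i_a}}\ \mathrm{PT}(1,\rho,n),$$ where $\alpha\sqcup\!\sqcup\,\sigma$ is the set of shuffles of $\alpha$ and $\sigma$, and $1\rho_{:i}$ is the initial segment of $(1,\rho)$ up to and including $i$. Then: 1. $\varphi^{\rm scalar+color}_n(\{i_1,\dots,i_m\}|1,\alpha,n)=(-1)^{n(n-1)/2}\,L$, so that up to an overall sign which depends only on $n$ (and is dropped by convention) the correlator equals $L$. 2. Let $\tilde A=A-\mathrm{diag}(V_1,\dots,V_n)$ with $V_i=\sum_{j\ne i}s_{ij}/z_{ij}$. The determinant form $\det(\tilde A_{\{i_1,\dots,i_m\}})\,\mathrm{PT}(1,\alpha,n)$ of the correlator, where only the rows and columns $i_1,\dots,i_m$ of $\tilde A$ are kept, equals $L$ exactly. 3. If $\alpha$ is empty, the coefficient of $\mathrm{PT}(1,\sigma,n)$ in $L$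 is the known BCJ numerator of the NLSM, the diagonal entry $S[\sigma|\sigma]_1$ of the momentum kernel, and $\varphi^{\rm scalar+color}_n=(-1)^{n(n-1)/2}\sum_{\sigma}S[\sigma|\sigma]_1\,\mathrm{PT}(1,\sigma,n)$. Here $S[\sigma|\tau]_1=\prod_{t}2p_{\sigma_t}\cdot\bigl(p_1+\sum_b p_b\bigr)$, the inner sum being over the labels $b$ that precede $\sigma_t$ both in $\sigma$ and in $\tau$. -/

import Mathlib

namespace PionString

/-- The (Laplace) Pfaffian of the skew matrix obtained from `M` by keeping the rows and columns
listed in `l`, in that order: expansion along the first listed row.  It is `1` for the empty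
list and `0` for lists of odd length. -/
def pfaffian {ι R : Type*} [CommRing R] (M : ι → ι → R) : List ι → R
  | [] => 1
  | a :: l => ∑ k : Fin l.length, (-1) ^ (k : ℕ) * M a (l.get k) * pfaffian M (l.eraseIdx k)
termination_by l => l.length
decreasing_by
  have h := k.isLt
  simp only [List.length_eraseIdx, List.length_cons]
  split <;> omega

/-- The list of all shuffles of two ordered lists, with multiplicity. -/
def shuffle {ι : Type*} : List ι → List ι → List (List ι)
  | [], l => [l]
  | l, [] => [l]
  | a :: l, b :: l' =>
      (shuffle l (b :: l')).map (a :: ·) ++ (shuffle (a :: l) l').map (b :: ·)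
termination_by l l' => l.length + l'.length

/-- The Parke–Taylor factor `1 / (z_{l₁ l₂} z_{l₂ l₃} ⋯ z_{l_k l₁})`. -/
def parkeTaylor {ι K : Type*} [Field K] (z : ι → K) (l : List ι) : K :=
  ((l.zipWith (fun a b => z a - z b) (l.rotate 1)).prod)⁻¹

/-- The Mandelstam variable `s_{ij} = 2 p_i · p_j`. -/
def mandelstam {ι K W : Type*} [Field K] [AddCommGroup W] [Module K W]
    (η : LinearMap.BilinForm K W) (p : ι → W) (i j : ι) : K :=
  2 * η (p i) (p j)

/-- `s_{i|J} = 2 p_i · ∑_{j ∈ J} p_j` for a list `J` of labels. -/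
def mandelstamSum {ι K W : Type*} [Field K] [AddCommGroup W] [Module K W]
    (η : LinearMap.BilinForm K W) (p : ι → W) (i : ι) (J : List ι) : K :=
  2 * η (p i) (J.map p).sum

/-- The initial segment of the list `l` up to and including `i`. -/
def upTo {ι : Type*} [DecidableEq ι] (l : List ι) (i : ι) : List ι :=
  l.take (l.idxOf i + 1)

/-- Formal variables for the Lorentz products that involve polarizations:
`ee s(i, j)` is `2 e_i · e_j` and `ep i j` is `2 e_i · p_j`. -/
inductive PolVar (ι : Type*) where
  | ee : Sym2 ι → PolVar ι
  | ep : ι → ι → PolVar ι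

section Correlators

variable {K W : Type*} [Field K] [AddCommGroup W] [Module K W]
  (η : LinearMap.BilinForm K W) {N : ℕ} (p : Fin (N + 2) → W) (z : Fin (N + 2) → K)

/-- The matrix `A`: `A_{ij} = s_{ij} / z_{ij}` off the diagonal and `A_{ii} = 0`. -/
def matA (i j : Fin (N + 2)) : K :=
  if i = j then 0 else mandelstam η p i j / (z i - z j)

/-- The function `V_i = ∑_{j ≠ i} s_{ij} / z_{ij}`. -/
def funV (i : Fin (N + 2)) : K :=
  ∑ j ∈ Finset.univ.erase i, mandelstam η p i j / (z i - z j)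

/-- The matrix `Ã = A - E`, where `E` is diagonal with entries `V_i`. -/
def matATilde : Matrix (Fin (N + 2)) (Fin (N + 2)) K :=
  Matrix.of (matA η p z) - Matrix.diagonal (funV η p z)

open MvPolynomial in
/-- The matrix `B`: `B_{ij} = 2 e_i · e_j / z_{ij}` off the diagonal and `B_{ii} = 0`. -/
noncomputable def matB (i j : Fin (N + 2)) : MvPolynomial (PolVar (Fin (N + 2))) K :=
  if i = j then 0 else C (z i - z j)⁻¹ * X (.ee s(i, j))

open MvPolynomial in
/-- The matrix `C`: `C_{ij} = 2 e_i · p_j / z_{ij}` off the diagonal and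
`C_{ii} = - ∑_{k ≠ i} 2 e_i · p_k / z_{ik}`. -/
noncomputable def matC (i j : Fin (N + 2)) : MvPolynomial (PolVar (Fin (N + 2))) K :=
  if i = j then - ∑ k ∈ Finset.univ.erase i, C (z i - z k)⁻¹ * X (.ep i k)
  else C (z i - z j)⁻¹ * X (.ep i j)

/-- The skew matrix `Ψ = (A, -Cᵀ; C, B)`; `inl i` is the index `i` and `inr i` the index
`n + i`. -/
noncomputable def matPsi : Fin (N + 2) ⊕ Fin (N + 2) → Fin (N + 2) ⊕ Fin (N + 2) →
    MvPolynomial (PolVar (Fin (N + 2))) K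
  | .inl i, .inl j => MvPolynomial.C (matA η p z i j)
  | .inl i, .inr j => - matC z j i
  | .inr i, .inl j => matC z i j
  | .inr i, .inr j => matB z i j

/-- `z_{ij}²` as a function of the unordered pair `{i, j}`. -/
def sqDiff : Sym2 (Fin (N + 2)) → K :=
  Sym2.lift ⟨fun i j => (z i - z j) ^ 2, fun i j => by ring⟩

open Classical in
/-- All sets of disjoint non-diagonal pairs of labels in `{2, …, n - 1}`, i.e. labels other than
the first and the last one. -/
noncomputable def pairings (N : ℕ) : Finset (Finset (Sym2 (Fin (N + 2)))) :=
  Finset.univ.filter fun ρ =>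
    (∀ e ∈ ρ, ¬ e.IsDiag ∧ (0 : Fin (N + 2)) ∉ e ∧ Fin.last (N + 1) ∉ e) ∧
    ∀ e ∈ ρ, ∀ e' ∈ ρ, e ≠ e' → ∀ i, i ∈ e → i ∉ e'

open Classical in
/-- The indices of `Ψ`, in increasing order, that are left after removal of the rows and columns
`1`, `n` and `i, j, n + i, n + j` for every pair `(ij)` in `ρ`. -/
noncomputable def psiIndices (ρ : Finset (Sym2 (Fin (N + 2)))) :
    List (Fin (N + 2) ⊕ Fin (N + 2)) :=
  (((List.finRange (N + 2)).filter fun i =>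
      i ≠ 0 ∧ i ≠ Fin.last (N + 1) ∧ ∀ e ∈ ρ, i ∉ e).map Sum.inl) ++
  (((List.finRange (N + 2)).filter fun i => ∀ e ∈ ρ, i ∉ e).map Sum.inr)

open MvPolynomial in
/-- The `n`-gluon open-superstring correlator, `n = N + 2`, with special legs `(1, n)`:
`(1 / z_{1n}) ∑_ρ (-α')^{-|ρ|} ∏_{(ij) ∈ ρ} (2 e_i · e_j / z_{ij}²) Pf Ψ^ρ_{1,n}`. -/
noncomputable def gaugeCorrelator (a' : K) : MvPolynomial (PolVar (Fin (N + 2))) K :=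
  C (z 0 - z (Fin.last (N + 1)))⁻¹ *
    ∑ ρ ∈ pairings N, C (((-a') ^ ρ.card)⁻¹) *
      (∏ e ∈ ρ, C (sqDiff z e)⁻¹ * X (.ee e)) * pfaffian (matPsi η p z) (psiIndices ρ)

/-- The operators `∏_i ∂_{2 e_{α_i} · (p_{α_{i-1}} - p_n)}`, where `α₀` is the first argument and
`∂_{2 e_a · (p_b - p_c)} = ∂_{2 e_a · p_b} - ∂_{2 e_a · p_c}`. -/
noncomputable def insertScalars (f : MvPolynomial (PolVar (Fin (N + 2))) K) :
    Fin (N + 2) → List (Fin (N + 2)) → MvPolynomial (PolVar (Fin (N + 2))) K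
  | _, [] => f
  | b, a :: l =>
      MvPolynomial.pderiv (.ep a b) (insertScalars f a l) -
        MvPolynomial.pderiv (.ep a (Fin.last (N + 1))) (insertScalars f a l)

/-- The correlator of gluons and of colored scalars ordered as `(1, α, n)`; the gluons are the
labels outside `1, α, n`. -/
noncomputable def gaugeColorCorrelator (a' : K) (α : List (Fin (N + 2))) :
    MvPolynomial (PolVar (Fin (N + 2))) K :=
  MvPolynomial.pderiv (.ee s(0, Fin.last (N + 1))) (insertScalars (gaugeCorrelator η p z a') 0 α)

/-- The dimensional reduction with all gluons of the second type,
`e_a · e_b → 0`, `e_a · p_b → p_a · p_b`. -/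
def dimReduce : PolVar (Fin (N + 2)) → K
  | .ee _ => 0
  | .ep a b => mandelstam η p a b

/-- The stringy correlator of pions and of colored scalars ordered as `(1, α, n)`: the dimensional
reduction of the correlator of gluons and colored scalars. -/
noncomputable def scalarColorCorrelator (a' : K) (α : List (Fin (N + 2))) : K :=
  MvPolynomial.eval (dimReduce η p) (gaugeColorCorrelator η p z a' α)

/-- The sum over permutations `σ` of the list `π` and over shuffles `ρ` of `α` and `σ` of
`∏_{i ∈ π} s_{i | 1ρ_{:i}} PT(1, ρ, n)`. -/
def logarithmicForm (α π : List (Fin (N + 2))) : K :=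
  (π.permutations.map fun σ => ((shuffle α σ).map fun ρ =>
    (π.map fun i => mandelstamSum η p i (upTo (0 :: ρ) i)).prod *
      parkeTaylor z (0 :: ρ ++ [Fin.last (N + 1)])).sum).sum

/-- The momentum kernel based at leg `1`,
`S[σ|τ]₁ = ∏_t 2 p_{σ_t} · (p_1 + ∑ p_b)`, the inner sum being over the labels `b` that precede
`σ_t` both in `σ` and in `τ`. -/
def momentumKernel (σ τ : List (Fin (N + 2))) : K :=
  ∏ t : Fin σ.length, mandelstamSum η p (σ.get t)
    (0 :: (σ.take t).filter fun b => τ.idxOf b < τ.idxOf (σ.get t))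

end Correlators

end PionString

/-! Correlator to determinant. Dimensional reduction kills every `2 e_i · e_j`, and only `2 e_1 ·
e_n` is differentiated before that, so all the others may be set to zero at the start (`killPol`).
Then only the empty `ρ` survives, which removes `α'`, and the `B` block of `Ψ` keeps a single skew
pair of entries in its corners. The Pfaffian collapses to a sign times `B_{1n}` times a minor of `C`
(`pfaffian_eq_listDet`). Only row `a` of `C` contains `e_a`, so each scalar insertion strips one row
and column and leaves a scalar factor (`insertScalars_listMinor`); these factors combine to `PT(1,
α, n)`. What remains of `C` reduces to `Ã`.

Determinant to `L`. Momentum conservation eliminates `s_{in}`, and row multilinearity expands the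
minor of `Ã` over maps `f` that give each pion `i` a parent `f i`, with weight `∏ s_{i, f i}`. On
the other side, expanding `∏ s_{i|1ρ_{:i}}` selects the same `f`, restricted to orderings `ρ` in
which parents come first. The two agree for each `f` separately
(`listMinor_edgeEntry_mul_pathWeight`), by induction on the number of pions. A pion that is nobody's
parent is a leaf: its column is diagonal, and its diagonal entry is the telescoping sum over all
slots after its parent (`sum_permutations'Aux_pathWeight_after`). If there is no leaf, `f` maps the
pions onto themselves: the determinant is singular, and no ordering is admissible. -/

namespace PionString

/-! ### Shuffles and insertion of a letter -/

section Insertions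

variable {ι A : Type*} [AddCommMonoid A]

theorem sum_map_permutations'Aux_cons (i b : ι) (l : List ι) (F : List ι → A) :
    ((List.permutations'Aux i (b :: l)).map F).sum =
      F (i :: b :: l) + ((List.permutations'Aux i l).map fun τ => F (b :: τ)).sum := by
  simp [List.permutations'Aux, Function.comp_def]

theorem shuffle_nil_left (l : List ι) : shuffle [] l = [l] := by
  simp [shuffle]

theorem shuffle_nil_right (l : List ι) : shuffle l [] = [l] := by
  cases l <;> simp [shuffle]

theorem sum_map_shuffle_cons (a b : ι) (l l' : List ι) (F : List ι → A) :
    ((shuffle (a :: l) (b :: l')).map F).sum =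
      ((shuffle l (b :: l')).map fun τ => F (a :: τ)).sum +
        ((shuffle (a :: l) l').map fun τ => F (b :: τ)).sum := by
  rw [shuffle]
  simp [Function.comp_def]

theorem sum_map_add' {X : Type*} (l : List X) (F G : X → A) :
    (l.map fun x => F x + G x).sum = (l.map F).sum + (l.map G).sum :=
  List.sum_map_add

/-- Inserting a letter commutes with shuffling. -/
theorem sum_shuffle_permutations'Aux (i : ι) (α σ : List ι) (F : List ι → A) :
    ((List.permutations'Aux i σ).map fun τ => ((shuffle α τ).map F).sum).sum =
      ((shuffle α σ).map fun ρ => ((List.permutations'Aux i ρ).map F).sum).sum := by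
  induction α generalizing σ F with
  | nil => simp [shuffle_nil_left]
  | cons a α ihα =>
    induction σ generalizing F with
    | nil =>
      have h := ihα [] fun τ => F (a :: τ)
      simp only [shuffle_nil_right, List.permutations'Aux, List.map_cons, List.map_nil,
        List.sum_cons, List.sum_nil, add_zero] at h ⊢
      rw [sum_map_shuffle_cons, h, shuffle_nil_right, List.map_map]
      simp [add_comm, Function.comp_def]
    | cons b σ ihσ =>
      have h1 := ihα (b :: σ) fun τ => F (a :: τ)
      have h2 := ihσ fun τ => F (b :: τ)
      rw [sum_map_permutations'Aux_cons] at h1 ⊢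
      simp only [sum_map_shuffle_cons, sum_map_add', sum_map_permutations'Aux_cons] at h1 h2 ⊢
      rw [← h1, ← h2]
      abel

/-- The sum of `F` over all ways to interleave `α` with all orderings of `π`. -/
def interleaveSum (α π : List ι) (F : List ι → A) : A :=
  (π.permutations.map fun σ => ((shuffle α σ).map F).sum).sum

theorem interleaveSum_nil (α : List ι) (F : List ι → A) : interleaveSum α [] F = F α := by
  simp [interleaveSum, shuffle_nil_right]

/-- Since insertion commutes with shuffling, a new letter can be inserted last, into a finished
word. This is the combinatorial form of attaching a leaf. -/
theorem interleaveSum_cons (α π : List ι) (i : ι) (F : List ι → A) :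
    interleaveSum α (i :: π) F =
      interleaveSum α π fun ρ => ((List.permutations'Aux i ρ).map F).sum := by
  unfold interleaveSum
  rw [((List.permutations_perm_permutations' (i :: π)).map _).sum_eq,
    ((List.permutations_perm_permutations' π).map _).sum_eq, List.permutations', List.map_flatMap,
    List.flatMap, List.sum_flatten, List.map_map]
  simp only [Function.comp_def, sum_shuffle_permutations'Aux]

theorem interleaveSum_perm (α : List ι) {π π' : List ι} (h : π.Perm π') (F : List ι → A) :
    interleaveSum α π F = interleaveSum α π' F := by
  unfold interleaveSum
  exact (h.permutations.map _).sum_eq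

theorem perm_of_mem_shuffle {α σ ρ : List ι} (h : ρ ∈ shuffle α σ) : ρ.Perm (α ++ σ) := by
  induction α generalizing σ ρ with
  | nil => simp_all [shuffle_nil_left]
  | cons a α ihα =>
    induction σ generalizing ρ with
    | nil => simp_all [shuffle_nil_right]
    | cons b σ ihσ =>
      rw [shuffle, List.mem_append, List.mem_map, List.mem_map] at h
      rcases h with ⟨τ, hτ, rfl⟩ | ⟨τ, hτ, rfl⟩
      · exact (ihα hτ).cons a
      · exact ((ihσ hτ).cons b).trans List.perm_middle.symm

theorem interleaveSum_congr {α π : List ι} {F G : List ι → A}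
    (h : ∀ ρ, ρ.Perm (α ++ π) → F ρ = G ρ) : interleaveSum α π F = interleaveSum α π G := by
  unfold interleaveSum
  refine congrArg _ (List.map_congr_left fun σ hσ => congrArg _ (List.map_congr_left fun ρ hρ => ?_))
  exact h ρ ((perm_of_mem_shuffle hρ).trans ((List.mem_permutations.1 hσ).append_left α))

theorem interleaveSum_sum {β : Type*} (s : Finset β) (α π : List ι) (F : β → List ι → A) :
    interleaveSum α π (fun ρ => ∑ b ∈ s, F b ρ) = ∑ b ∈ s, interleaveSum α π (F b) := by
  classical
  unfold interleaveSum
  induction s using Finset.induction_on with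
  | empty => simp
  | insert b s hb ih => simp only [Finset.sum_insert hb, sum_map_add', ih]

theorem interleaveSum_mul_left {R : Type*} [CommSemiring R] (c : R) (α π : List ι)
    (F : List ι → R) : interleaveSum α π (fun ρ => c * F ρ) = c * interleaveSum α π F := by
  simp only [interleaveSum, List.sum_map_mul_left]

end Insertions

/-! ### Initial segments of a word -/

section UpTo

variable {ι : Type*} [DecidableEq ι]

theorem mem_upTo_iff {l : List ι} {i x : ι} :
    x ∈ upTo l i ↔ x ∈ l ∧ l.idxOf x ≤ l.idxOf i := by
  unfold upTo
  constructor
  · intro h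
    have hx := List.mem_of_mem_take h
    exact ⟨hx, Nat.lt_succ_iff.1 ((List.mem_take_iff_idxOf_lt hx).1 h)⟩
  · rintro ⟨hx, h⟩
    exact (List.mem_take_iff_idxOf_lt hx).2 (Nat.lt_succ_of_le h)

theorem upTo_cons_self (i : ι) (l : List ι) : upTo (i :: l) i = [i] := by
  simp [upTo]

theorem upTo_cons_of_ne {a i : ι} (h : a ≠ i) (l : List ι) :
    upTo (a :: l) i = a :: upTo l i := by
  simp [upTo, List.idxOf_cons_ne _ h]

/-- Inserting `i` does not change the relative order of the other letters. -/
theorem mem_upTo_permutations'Aux {i j x : ι} (hj : j ≠ i) (hx : x ≠ i) {ρ τ : List ι}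
    (hτ : τ ∈ List.permutations'Aux i ρ) (hi : i ∉ ρ) : x ∈ upTo τ j ↔ x ∈ upTo ρ j := by
  induction ρ generalizing τ with
  | nil =>
    simp only [List.permutations'Aux, List.mem_singleton] at hτ
    subst hτ
    rw [upTo_cons_of_ne hj.symm]
    simp [upTo, hx]
  | cons b ρ ih =>
    simp only [List.permutations'Aux, List.mem_cons, List.mem_map] at hτ
    rcases hτ with rfl | ⟨τ, hτ, rfl⟩
    · rw [upTo_cons_of_ne hj.symm]
      simp [hx]
    · by_cases hb : b = j
      · subst hb
        simp [upTo_cons_self]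
      · rw [upTo_cons_of_ne hb, upTo_cons_of_ne hb, List.mem_cons, List.mem_cons,
          ih hτ fun h => hi (List.mem_cons_of_mem _ h)]

theorem mem_upTo_cons_permutations'Aux {i j x a : ι} (hj : j ≠ i) (hx : x ≠ i) {ρ τ : List ι}
    (hτ : τ ∈ List.permutations'Aux i ρ) (hi : i ∉ ρ) :
    x ∈ upTo (a :: τ) j ↔ x ∈ upTo (a :: ρ) j := by
  by_cases ha : a = j
  · subst ha
    simp [upTo_cons_self]
  · rw [upTo_cons_of_ne ha, upTo_cons_of_ne ha, List.mem_cons, List.mem_cons,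
      mem_upTo_permutations'Aux hj hx hτ hi]

end UpTo

/-! ### Path weights and their partial fractions -/

section PathWeight

variable {ι K : Type*} [Field K]

/-- The product of `1 / z_{ab}` over consecutive labels of `a :: l`. -/
def pathWeight (z : ι → K) : ι → List ι → K
  | _, [] => 1
  | a, b :: l => (z a - z b)⁻¹ * pathWeight z b l

/-- The closing label `c` is kept apart from the starting label `a`, because the induction moves
only the latter. -/
theorem inv_prod_zipWith_eq_pathWeight (z : ι → K) (a n c : ι) (l : List ι) :
    ((List.zipWith (fun a b => z a - z b) (a :: (l ++ [n])) (l ++ [n] ++ [c])).prod)⁻¹ =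
      pathWeight z a (l ++ [n]) * (z n - z c)⁻¹ := by
  induction l generalizing a with
  | nil => simp [pathWeight, mul_comm]
  | cons b l ih =>
    simp only [List.cons_append, List.zipWith_cons_cons, List.prod_cons, mul_inv, pathWeight] at ih ⊢
    rw [ih, mul_assoc]

theorem parkeTaylor_eq_pathWeight (z : ι → K) (a n : ι) (l : List ι) :
    parkeTaylor z (a :: l ++ [n]) = pathWeight z a (l ++ [n]) * (z n - z a)⁻¹ := by
  rw [← inv_prod_zipWith_eq_pathWeight]
  simp [parkeTaylor]

/-- Inserting `i` between neighbours `u, v` multiplies the weight by `z_{uv} / (z_{ui} z_{iv}) =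
1/z_{ui} - 1/z_{vi}`, and these differences telescope from `a` to `n`. -/
theorem sum_permutations'Aux_pathWeight {z : ι → K} (hz : Function.Injective z) (a i n : ι)
    (ρ : List ι) (h : (a :: i :: (ρ ++ [n])).Nodup) :
    ((List.permutations'Aux i ρ).map fun τ => pathWeight z a (τ ++ [n])).sum =
      ((z a - z i)⁻¹ - (z n - z i)⁻¹) * pathWeight z a (ρ ++ [n]) := by
  have hne : ∀ {x y : ι}, x ≠ y → z x - z y ≠ 0 := fun hxy => sub_ne_zero.2 (hz.ne hxy)
  induction ρ generalizing a with
  | nil =>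
    simp only [List.nil_append, List.nodup_cons, List.mem_cons, List.not_mem_nil, or_false,
      not_or] at h
    have h1 := hne h.1.1
    have h2 := hne h.1.2
    have h3 := hne h.2.1
    have h4 := hne (Ne.symm h.2.1)
    simp only [List.permutations'Aux, List.map_cons, List.map_nil, List.sum_cons, List.sum_nil,
      List.cons_append, List.nil_append, pathWeight]
    field_simp
    ring
  | cons b ρ ih =>
    have hb : (b :: i :: (ρ ++ [n])).Nodup :=
      (List.Perm.swap b i _).nodup_iff.1 (List.nodup_cons.1 h).2
    rw [sum_map_permutations'Aux_cons]
    simp only [List.cons_append, pathWeight, List.sum_map_mul_left]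
    rw [ih b hb]
    simp only [List.cons_append, List.nodup_cons, List.mem_cons, List.mem_append, List.not_mem_nil,
      or_false, not_or] at h
    have h1 := hne h.1.1
    have h2 := hne h.1.2.1
    have h3 := hne h.2.1.1
    have h4 := hne (Ne.symm h.2.1.1)
    have h5 := hne (Ne.symm h.2.1.2.2)
    field_simp
    ring

/-- The same telescoping, started at `x` because earlier slots are excluded. For `x = n` no slot is
left and the factor vanishes as well. -/
theorem sum_permutations'Aux_pathWeight_after [DecidableEq ι] {z : ι → K}
    (hz : Function.Injective z) (a i n x : ι) (ρ : List ι) (h : (a :: i :: (ρ ++ [n])).Nodup)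
    (hx : x ∈ a :: (ρ ++ [n])) :
    ((List.permutations'Aux i ρ).map fun τ =>
        if x ∈ upTo (a :: τ) i then pathWeight z a (τ ++ [n]) else 0).sum =
      ((z x - z i)⁻¹ - (z n - z i)⁻¹) * pathWeight z a (ρ ++ [n]) := by
  have hai : a ≠ i := fun h' => (List.nodup_cons.1 h).1 (by simp [h'])
  by_cases hxa : x = a
  · subst hxa
    simp only [upTo_cons_of_ne hai, List.mem_cons, true_or, if_true]
    exact sum_permutations'Aux_pathWeight hz x i n ρ h
  have hx' : x ∈ ρ ++ [n] := (List.mem_cons.1 hx).resolve_left hxa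
  have hxi : x ≠ i := fun h' => (List.nodup_cons.1 (List.nodup_cons.1 h).2).1 (h' ▸ hx')
  induction ρ generalizing a with
  | nil =>
    have : x = n := by simpa using hx'
    subst this
    simp [upTo_cons_of_ne hai, upTo_cons_self, List.permutations'Aux, hxa, hxi]
  | cons b ρ ih =>
    have hb : (b :: i :: (ρ ++ [n])).Nodup :=
      (List.Perm.swap b i _).nodup_iff.1 (List.nodup_cons.1 h).2
    have hbi : b ≠ i := fun h' => (List.nodup_cons.1 hb).1 (by simp [h'])
    rw [sum_map_permutations'Aux_cons]
    simp only [upTo_cons_of_ne hai, upTo_cons_self, List.mem_cons, List.not_mem_nil, hxa, hxi,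
      false_or, or_false, if_false, zero_add, List.cons_append, pathWeight]
    have key : ((List.permutations'Aux i ρ).map fun τ =>
        if x ∈ upTo (b :: τ) i then pathWeight z b (τ ++ [n]) else 0).sum =
      ((z x - z i)⁻¹ - (z n - z i)⁻¹) * pathWeight z b (ρ ++ [n]) := by
      by_cases hxb : x = b
      · subst hxb
        simp only [upTo_cons_of_ne hbi, List.mem_cons, true_or, if_true]
        exact sum_permutations'Aux_pathWeight hz x i n ρ hb
      · have hx'' : x ∈ ρ ++ [n] := (List.mem_cons.1 hx').resolve_left hxb
        exact ih b hb hx' hbi hxb hx''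
    rw [mul_left_comm, ← key, ← List.sum_map_mul_left]
    simp only [mul_ite, mul_zero]

end PathWeight

/-! ### Principal minors indexed by lists -/

section ListDet

variable {ι R : Type*} [CommRing R]

/-- The principal minor of `M` on the rows and columns listed in `l`. -/
def listMinor (M : ι → ι → R) (l : List ι) : R :=
  (Matrix.of fun s t : Fin l.length => M (l.get s) (l.get t)).det

theorem listMinor_nil (M : ι → ι → R) : listMinor M [] = 1 :=
  Matrix.det_fin_zero

theorem listMinor_perm (M : ι → ι → R) {l l' : List ι} (hl : l.Nodup) (h : l.Perm l') :
    listMinor M l = listMinor M l' := by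
  classical
  let e : Fin l.length ≃ Fin l'.length :=
    ((List.Nodup.getEquiv l hl).trans (Equiv.subtypeEquivRight fun _ => h.mem_iff)).trans
      (List.Nodup.getEquiv l' (h.nodup_iff.1 hl)).symm
  have he : ∀ s, l'.get (e s) = l.get s := by
    intro s
    have := (List.Nodup.getEquiv l' (h.nodup_iff.1 hl)).apply_symm_apply
      ⟨l.get s, h.mem_iff.1 (List.get_mem l s)⟩
    exact congrArg Subtype.val this
  unfold listMinor
  rw [← Matrix.det_submatrix_equiv_self e]
  congr 1
  ext s t
  simp only [Matrix.submatrix_apply, Matrix.of_apply, he]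

theorem listMinor_cons_of_column {M : ι → ι → R} {i : ι} {l : List ι}
    (h : ∀ j ∈ l, M j i = 0) : listMinor M (i :: l) = M i i * listMinor M l := by
  unfold listMinor
  refine (Matrix.det_succ_column_zero (n := l.length) _).trans ?_
  rw [Fin.sum_univ_succ, Finset.sum_eq_zero]
  · simp [Matrix.submatrix]
  · intro s _
    have hs : M l[(s : ℕ)] i = 0 := h _ (List.getElem_mem _)
    simp [hs]

end ListDet

/-! ### Matrix-tree expansion over parent maps -/

section Forest

variable {ι K : Type*} [DecidableEq ι] [Field K]

/-- The coefficient of `s_{ix}` in the entry `(i, k)` of `Ã`, once the label `n` has been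
eliminated by momentum conservation. -/
def edgeEntry (z : ι → K) (n x i k : ι) : K :=
  (if k = x then (z i - z x)⁻¹ else 0) -
    if k = i then (z i - z x)⁻¹ - (z i - z n)⁻¹ else 0

/-- The vector with entries `z_i - z_n` lies in the kernel: in row `i` it gives `(z_{f i} - z_i) /
(z_i - z_{f i}) + 1 = 0`. -/
theorem listMinor_edgeEntry_eq_zero {z : ι → K} (hz : Function.Injective z) {n : ι} {π : List ι}
    {f : ι → ι} (hπ : π.Nodup) (hne : π ≠ []) (hn : n ∉ π) (hfi : ∀ i ∈ π, f i ≠ i)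
    (hf : ∀ i ∈ π, f i ∈ π) : listMinor (fun i => edgeEntry z n (f i) i) π = 0 := by
  refine Matrix.exists_mulVec_eq_zero_iff.1 ⟨fun t => z (π.get t) - z n, ?_, ?_⟩
  · intro h
    have h0 := congrFun h ⟨0, List.length_pos_iff.2 hne⟩
    exact hn (hz (sub_eq_zero.1 h0) ▸ List.get_mem _ _)
  · ext s
    have hsπ : π.get s ∈ π := List.get_mem _ _
    obtain ⟨t, ht⟩ := List.get_of_mem (hf _ hsπ)
    have hinj : ∀ u v, π.get u = π.get v ↔ u = v := fun u v => hπ.injective_get.eq_iff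
    have h1 : z (π.get s) - z (π.get t) ≠ 0 :=
      sub_ne_zero.2 (hz.ne fun h => hfi _ hsπ (ht.symm.trans h.symm))
    have h2 : z (π.get s) - z n ≠ 0 := sub_ne_zero.2 (hz.ne fun h => hn (h ▸ hsπ))
    simp only [Matrix.mulVec, dotProduct, Matrix.of_apply, edgeEntry, ← ht, hinj, sub_mul,
      ite_mul, zero_mul, Finset.sum_sub_distrib, Finset.sum_ite_eq', Finset.mem_univ, if_true,
      Pi.zero_apply]
    field_simp
    ring

/-- Pigeonhole: the image of `π` contains `π` and is no larger, so it equals `π`. -/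
theorem mem_of_no_leaf {π : List ι} {f : ι → ι} (h : ∀ i ∈ π, ∃ j ∈ π, f j = i) :
    ∀ i ∈ π, f i ∈ π := by
  have hsub : π.toFinset ⊆ π.toFinset.image f := by
    intro i hi
    obtain ⟨j, hj, hji⟩ := h i (List.mem_toFinset.1 hi)
    exact Finset.mem_image.2 ⟨j, List.mem_toFinset.2 hj, hji⟩
  have heq := Finset.eq_of_subset_of_card_le hsub Finset.card_image_le
  intro i hi
  rw [← List.mem_toFinset, heq]
  exact Finset.mem_image_of_mem f (List.mem_toFinset.2 hi)

/-- The label of `π` that occurs first in `l` would need a parent in `π` occurring strictly earlier.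
-/
theorem not_forall_mem_upTo {π l : List ι} {f : ι → ι} (hne : π ≠ []) (hl : π ⊆ l)
    (hfi : ∀ i ∈ π, f i ≠ i) (hf : ∀ i ∈ π, f i ∈ π) : ¬ ∀ i ∈ π, f i ∈ upTo l i := by
  intro h
  obtain ⟨i, hi, hmin⟩ := Finset.exists_min_image π.toFinset l.idxOf
    ((List.toFinset_nonempty_iff _).2 hne)
  rw [List.mem_toFinset] at hi
  have h1 := hmin (f i) (List.mem_toFinset.2 (hf i hi))
  have h2 := (mem_upTo_iff.1 (h i hi)).2
  exact hfi i hi ((List.idxOf_inj (hl (hf i hi))).1 (le_antisymm h2 h1))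

/-- The contribution of one map `f`, sending each label in `π` to a parent: the sum of the path
weights over all orderings in which every parent comes first is a determinant. -/
theorem listMinor_edgeEntry_mul_pathWeight {z : ι → K} (hz : Function.Injective z) (r n : ι)
    (α π : List ι) (f : ι → ι) (hnd : (r :: (α ++ π) ++ [n]).Nodup)
    (hf : ∀ i ∈ π, f i ≠ i ∧ f i ∈ r :: (α ++ π) ++ [n]) :
    listMinor (fun i => edgeEntry z n (f i) i) π * pathWeight z r (α ++ [n]) =
      interleaveSum α π fun ρ =>
        if ∀ i ∈ π, f i ∈ upTo (r :: ρ) i then pathWeight z r (ρ ++ [n]) else 0 := by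
  induction hk : π.length generalizing π with
  | zero =>
    obtain rfl := List.length_eq_zero_iff.1 hk
    simp [listMinor_nil, interleaveSum_nil]
  | succ k ih =>
    have hne : π ≠ [] := by
      rintro rfl
      simp at hk
    have hπ : π.Nodup :=
      hnd.sublist (((List.sublist_append_right α π).cons r).trans (List.sublist_append_left _ _))
    have hnπ : n ∉ π := by
      intro h
      have := (List.nodup_append.1 hnd).2.2 n (by simp [h]) n (by simp)
      exact this rfl
    -- A leaf `i` is removed from both sides at once: its column has only a diagonal entry, and no
    -- other label's condition refers to it.
    by_cases hleaf : ∃ i ∈ π, ∀ j ∈ π, f j ≠ i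
    · obtain ⟨i, hi, hleaf⟩ := hleaf
      have hperm := List.perm_cons_erase hi
      generalize π.erase i = π' at hperm
      have hbig : (r :: (α ++ π) ++ [n]).Perm (i :: (r :: (α ++ π') ++ [n])) := by
        have h1 : (α ++ π).Perm (i :: (α ++ π')) :=
          (hperm.append_left α).trans List.perm_middle
        exact ((h1.cons r).trans (List.Perm.swap i r _)).append_right [n]
      have hnd' := hbig.nodup_iff.1 hnd
      have hiπ' : i ∉ π' := fun h => (List.nodup_cons.1 hnd').1 (by simp [h])
      have hmem' : ∀ j ∈ π, f j ∈ r :: (α ++ π') ++ [n] := fun j hj =>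
        (List.mem_cons.1 (hbig.mem_iff.1 (hf j hj).2)).resolve_left (hleaf j hj)
      have hπ'π : ∀ j ∈ π', j ∈ π := fun j hj => hperm.mem_iff.2 (List.mem_cons_of_mem _ hj)
      have hlen : π'.length = k := by
        have := hperm.length_eq
        simp only [List.length_cons] at this
        omega
      have key := ih π' (List.nodup_cons.1 hnd').2
        (fun j hj => ⟨(hf j (hπ'π j hj)).1, hmem' j (hπ'π j hj)⟩) hlen
      have hne_of_mem : ∀ j ∈ π', j ≠ i := fun j hj h => hiπ' (h ▸ hj)
      have hdet : listMinor (fun i => edgeEntry z n (f i) i) π =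
          ((z (f i) - z i)⁻¹ - (z n - z i)⁻¹) *
            listMinor (fun i => edgeEntry z n (f i) i) π' := by
        rw [listMinor_perm _ hπ hperm, listMinor_cons_of_column]
        · congr 1
          rw [← neg_sub (z i) (z (f i)), ← neg_sub (z i) (z n), inv_neg, inv_neg]
          simp only [edgeEntry, if_neg (hleaf i hi).symm, if_true]
          ring
        · intro j hj
          simp [edgeEntry, (hleaf j (hπ'π j hj)).symm, (hne_of_mem j hj).symm]
      rw [hdet, mul_assoc, key, interleaveSum_perm α hperm, interleaveSum_cons,
        ← interleaveSum_mul_left]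
      refine interleaveSum_congr fun ρ hρ => ?_
      have hρbig : (i :: (r :: (α ++ π') ++ [n])).Perm (i :: (r :: ρ ++ [n])) :=
        ((hρ.symm.cons r).append_right [n]).cons i
      have hρnd : (r :: i :: (ρ ++ [n])).Nodup :=
        (List.Perm.swap r i _).nodup_iff.1 (hρbig.nodup_iff.1 hnd')
      have hiρ : i ∉ ρ := fun h => (List.nodup_cons.1 (List.nodup_cons.1 hρnd).2).1 (by simp [h])
      have hfiρ : f i ∈ r :: (ρ ++ [n]) :=
        ((hρ.symm.cons r).append_right [n]).mem_iff.1 (hmem' i hi)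
      -- As `i` is nobody's parent, the conditions on the other labels do not depend on the slot of
      -- `i`; only the condition on `i` itself does.
      have hcond : ∀ τ ∈ List.permutations'Aux i ρ,
          (∀ j ∈ π, f j ∈ upTo (r :: τ) j) ↔
            f i ∈ upTo (r :: τ) i ∧ ∀ j ∈ π', f j ∈ upTo (r :: ρ) j := by
        intro τ hτ
        have h1 : (∀ j ∈ π, f j ∈ upTo (r :: τ) j) ↔ ∀ j ∈ i :: π', f j ∈ upTo (r :: τ) j :=
          forall_congr' fun j => by rw [hperm.mem_iff]
        rw [h1, List.forall_mem_cons]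
        refine and_congr_right fun _ => forall₂_congr fun j hj => ?_
        exact mem_upTo_cons_permutations'Aux (hne_of_mem j hj) (hleaf j (hπ'π j hj)) hτ hiρ
      rw [List.map_congr_left (g := fun τ => if f i ∈ upTo (r :: τ) i ∧
        ∀ j ∈ π', f j ∈ upTo (r :: ρ) j then pathWeight z r (τ ++ [n]) else 0)
        fun τ hτ => if_congr (hcond τ hτ) rfl rfl]
      by_cases hc : ∀ j ∈ π', f j ∈ upTo (r :: ρ) j
      · rw [if_pos hc, ← sum_permutations'Aux_pathWeight_after hz r i n (f i) ρ hρnd hfiρ]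
        exact congrArg _ (List.map_congr_left fun τ _ => if_congr (and_iff_left hc).symm rfl rfl)
      · simp [hc]
    · push Not at hleaf
      have hfπ := mem_of_no_leaf hleaf
      have hfi : ∀ i ∈ π, f i ≠ i := fun i hi => (hf i hi).1
      rw [listMinor_edgeEntry_eq_zero hz hπ hne hnπ hfi hfπ, zero_mul]
      symm
      -- Zero is written as a product so that `interleaveSum_mul_left` can pull out a zero factor.
      rw [interleaveSum_congr (G := fun _ => (0 : K) * 0), interleaveSum_mul_left, zero_mul]
      intro ρ hρ
      rw [if_neg, mul_zero]
      refine not_forall_mem_upTo hne (fun i hi => ?_) hfi hfπ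
      exact List.mem_cons_of_mem _ (hρ.mem_iff.2 (List.mem_append_right _ hi))

variable [Fintype ι]

/-- The weighted matrix-tree expansion: a determinant with rows `∑_x s_{ix} edgeEntry z n x i` is
the sum over all interleavings of the products of partial row sums, weighted by path weights. -/
theorem listMinor_sum_edgeEntry_mul_pathWeight {z : ι → K} (hz : Function.Injective z) (r n : ι)
    (α π : List ι) (s : ι → ι → K) (hs : ∀ i, s i i = 0)
    (hl : ∀ i, i ∈ r :: (α ++ π) ++ [n]) (hnd : (r :: (α ++ π) ++ [n]).Nodup) :
    listMinor (fun i k => ∑ x, s i x * edgeEntry z n x i k) π * pathWeight z r (α ++ [n]) =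
      interleaveSum α π fun ρ =>
        (π.map fun i => ∑ x, if x ∈ upTo (r :: ρ) i then s i x else 0).prod *
          pathWeight z r (ρ ++ [n]) := by
  have hπ : π.Nodup :=
    hnd.sublist (((List.sublist_append_right α π).cons r).trans (List.sublist_append_left _ _))
  -- Row multilinearity: choosing one summand `x` in each row amounts to choosing a parent map `g`.
  have hdet : listMinor (fun i k => ∑ x, s i x * edgeEntry z n x i k) π =
      ∑ g : Fin π.length → ι, (∏ t, s (π.get t) (g t)) *
        (Matrix.of fun a b => edgeEntry z n (g a) (π.get a) (π.get b)).det := by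
    have hrow : (Matrix.of fun a b : Fin π.length =>
        ∑ x, s (π.get a) x * edgeEntry z n x (π.get a) (π.get b)) =
        fun a => ∑ x, s (π.get a) x • fun b => edgeEntry z n x (π.get a) (π.get b) := by
      ext a b
      simp
    unfold listMinor
    rw [hrow]
    have h := (Matrix.detRowAlternating (R := K) (n := Fin π.length)).toMultilinearMap.map_sum
      fun a x => s (π.get a) x • fun b => edgeEntry z n x (π.get a) (π.get b)
    refine h.trans (Finset.sum_congr rfl fun g _ => ?_)
    refine (MultilinearMap.map_smul_univ _ _ _).trans ?_
    rfl
  have hprod : ∀ ρ, (π.map fun i => ∑ x, if x ∈ upTo (r :: ρ) i then s i x else 0).prod =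
      ∑ g : Fin π.length → ι, (∏ t, s (π.get t) (g t)) *
        if ∀ t, g t ∈ upTo (r :: ρ) (π.get t) then 1 else 0 := by
    intro ρ
    have h1 : (π.map fun i => ∑ x, if x ∈ upTo (r :: ρ) i then s i x else 0).prod =
        ∏ t : Fin π.length, ∑ x, if x ∈ upTo (r :: ρ) (π.get t) then s (π.get t) x else 0 := by
      rw [← List.prod_ofFn]
      congr 1
      conv_lhs => rw [← List.ofFn_get π, List.map_ofFn]
      rfl
    rw [h1, Finset.prod_univ_sum, Fintype.piFinset_univ]
    refine Finset.sum_congr rfl fun g _ => ?_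
    rw [Finset.prod_ite_zero]
    simp
  simp only [hprod, Finset.sum_mul]
  rw [hdet, Finset.sum_mul, interleaveSum_sum]
  refine Finset.sum_congr rfl fun g _ => ?_
  simp only [mul_assoc]
  rw [interleaveSum_mul_left]
  -- A label that is its own parent contributes the factor `s i i = 0`; the remaining maps have no
  -- fixed point, as the forest lemma requires.
  by_cases hg : ∃ t, g t = π.get t
  · obtain ⟨t, ht⟩ := hg
    rw [Finset.prod_eq_zero (Finset.mem_univ t) (by rw [ht, hs]), zero_mul, zero_mul]
  push Not at hg
  congr 1
  have hinj := hπ.injective_get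
  -- The map on positions becomes a map on labels; its values outside `π`, here those of `id`, play
  -- no role.
  have hfg : ∀ t, Function.extend π.get g id (π.get t) = g t := fun t => hinj.extend_apply g id t
  have h := listMinor_edgeEntry_mul_pathWeight hz r n α π (Function.extend π.get g id) hnd ?_
  · have hdet' : listMinor (fun i => edgeEntry z n (Function.extend π.get g id i) i) π =
        (Matrix.of fun a b => edgeEntry z n (g a) (π.get a) (π.get b)).det := by
      simp only [listMinor, hfg]
    rw [← hdet', h]
    congr 1
    ext ρ
    have hiff : (∀ i ∈ π, Function.extend π.get g id i ∈ upTo (r :: ρ) i) ↔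
        ∀ t, g t ∈ upTo (r :: ρ) (π.get t) := by
      rw [List.forall_mem_iff_get]
      simp only [hfg]
    simp only [hiff, ite_mul, one_mul, zero_mul]
  · intro i hi
    obtain ⟨t, rfl⟩ := List.get_of_mem hi
    rw [hfg]
    exact ⟨hg t, hl _⟩

end Forest

/-! ### Alternating sums and Laplace expansion along lists -/

section AltSum

variable {ι R : Type*} [CommRing R]

/-- The alternating sum `∑ₖ (-1)ᵏ F(lₖ, l without its k-th entry)`. -/
def altSum (F : ι → List ι → R) (l : List ι) : R :=
  ∑ k : Fin l.length, (-1) ^ (k : ℕ) * F (l.get k) (l.eraseIdx k)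

theorem pfaffian_cons (M : ι → ι → R) (a : ι) (l : List ι) :
    pfaffian M (a :: l) = altSum (fun b l' => M a b * pfaffian M l') l := by
  rw [pfaffian]
  simp only [altSum, mul_assoc]

theorem altSum_cons (F : ι → List ι → R) (a : ι) (l : List ι) :
    altSum F (a :: l) = F a l - altSum (fun b l' => F b (a :: l')) l := by
  unfold altSum
  refine (Fin.sum_univ_succ (n := l.length) _).trans ?_
  rw [sub_eq_add_neg, ← Finset.sum_neg_distrib]
  congr 1
  · simp
  · refine Finset.sum_congr rfl fun k _ => ?_
    simp [pow_succ]

theorem altSum_nil (F : ι → List ι → R) : altSum F [] = 0 := by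
  simp [altSum]

theorem altSum_append (F : ι → List ι → R) (l l' : List ι) :
    altSum F (l ++ l') = altSum (fun b x => F b (x ++ l')) l +
      (-1) ^ l.length * altSum (fun b y => F b (l ++ y)) l' := by
  induction l generalizing F with
  | nil => simp [altSum_nil]
  | cons a l ih =>
    rw [List.cons_append, altSum_cons, altSum_cons, ih]
    simp only [List.cons_append, List.length_cons, pow_succ]
    ring

theorem altSum_map {κ : Type*} (F : κ → List κ → R) (g : ι → κ) (l : List ι) :
    altSum F (l.map g) = altSum (fun b x => F (g b) (x.map g)) l := by
  induction l generalizing F with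
  | nil => simp [altSum_nil]
  | cons a l ih => rw [List.map_cons, altSum_cons, altSum_cons, ih]; rfl

theorem altSum_congr {F G : ι → List ι → R} {l : List ι}
    (h : ∀ b x, b ∈ l → x.Sublist l → x.length + 1 = l.length → F b x = G b x) :
    altSum F l = altSum G l := by
  refine Finset.sum_congr rfl fun k _ => ?_
  rw [h _ _ (List.get_mem _ _) (List.eraseIdx_sublist _ _)
    (List.length_eraseIdx_add_one k.isLt)]

theorem altSum_eq_zero {F : ι → List ι → R} {l : List ι}
    (h : ∀ b x, b ∈ l → x.Sublist l → x.length + 1 = l.length → F b x = 0) :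
    altSum F l = 0 := by
  rw [altSum_congr (G := fun _ _ => 0) h]
  simp [altSum]

theorem altSum_mul_left (c : R) (F : ι → List ι → R) (l : List ι) :
    altSum (fun b x => c * F b x) l = c * altSum F l := by
  simp only [altSum, Finset.mul_sum, mul_left_comm]

/-- The determinant with rows `r` and columns `l`, by expansion along the first column. -/
def listDet (M : ι → ι → R) : List ι → List ι → R
  | _, [] => 1
  | r, a :: l => altSum (fun b y => M b a * listDet M y l) r

/-- The size `k` is a separate variable, so that rows and columns share one index type throughout
the induction. -/
theorem listDet_eq_det (M : ι → ι → R) (k : ℕ) (r l : List ι) (hr : k = r.length)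
    (hl : k = l.length) : listDet M r l =
      (Matrix.of fun s t : Fin k => M (r.get (s.cast hr)) (l.get (t.cast hl))).det := by
  induction k generalizing r l with
  | zero =>
    obtain rfl := List.length_eq_zero_iff.1 hl.symm
    simp [listDet]
  | succ k ih =>
    obtain ⟨a, l, rfl⟩ := List.exists_cons_of_length_eq_add_one hl.symm
    rw [Matrix.det_succ_column_zero, listDet, altSum, ← (finCongr hr).sum_comp]
    refine Finset.sum_congr rfl fun i _ => ?_
    have hlen : k = (r.eraseIdx (finCongr hr i : Fin r.length)).length := by
      have := List.length_eraseIdx_add_one (finCongr hr i).isLt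
      omega
    rw [ih _ l hlen (by simpa using hl), ← mul_assoc]
    congr 2
    ext s t
    have hget : (r.eraseIdx (finCongr hr i : Fin r.length)).get (s.cast hlen) =
        r.get ((i.succAbove s).cast hr) := by
      simp only [List.get_eq_getElem, Fin.val_cast, List.getElem_eraseIdx, finCongr_apply]
      by_cases h : s.castSucc < i
      · have h' : (s : ℕ) < i := h
        simp [Fin.succAbove_of_castSucc_lt _ _ h, h']
      · have h' : ¬ (s : ℕ) < i := h
        simp [Fin.succAbove_of_le_castSucc _ _ (not_lt.1 h), h']
    simp only [Matrix.of_apply, Matrix.submatrix_apply, hget]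
    rfl

theorem listDet_self (M : ι → ι → R) (l : List ι) : listDet M l l = listMinor M l :=
  listDet_eq_det M l.length l l rfl rfl

end AltSum

/-! ### Pfaffians with an almost isotropic block -/

section Pfaffian

variable {ι R : Type*} [CommRing R] (M : ι ⊕ ι → ι ⊕ ι → R)

theorem pfaffian_inl_cons (a : ι) (l r : List ι) :
    pfaffian M ((a :: l).map Sum.inl ++ r.map Sum.inr) =
      altSum (fun b x => M (.inl a) (.inl b) *
          pfaffian M (x.map Sum.inl ++ r.map Sum.inr)) l +
        (-1) ^ l.length * altSum (fun b y => M (.inl a) (.inr b) *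
          pfaffian M (l.map Sum.inl ++ y.map Sum.inr)) r := by
  rw [List.map_cons, List.cons_append, pfaffian_cons, altSum_append, altSum_map, altSum_map,
    List.length_map]

theorem pfaffian_inr_cons (a : ι) (r : List ι) :
    pfaffian M ((a :: r).map Sum.inr) =
      altSum (fun b y => M (.inr a) (.inr b) * pfaffian M (y.map Sum.inr)) r := by
  rw [List.map_cons, pfaffian_cons, altSum_map]

/-- In a nonzero term every label of `r` would be matched with one of `l`, and there are too few of
these. -/
theorem pfaffian_eq_zero_of_isotropic (l r : List ι)
    (h : ∀ a ∈ r, ∀ b ∈ r, M (.inr a) (.inr b) = 0) (hlt : l.length < r.length) :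
    pfaffian M (l.map Sum.inl ++ r.map Sum.inr) = 0 := by
  induction hk : l.length using Nat.strong_induction_on generalizing l r with
  | _ k ih =>
    cases l with
    | nil =>
      obtain ⟨a, r, rfl⟩ := List.exists_cons_of_length_pos hlt
      rw [List.map_nil, List.nil_append, pfaffian_inr_cons]
      refine altSum_eq_zero fun b x hb _ _ => ?_
      rw [h a (by simp) b (by simp [hb]), zero_mul]
    | cons a l =>
      simp only [List.length_cons] at hk hlt
      rw [pfaffian_inl_cons, altSum_eq_zero, altSum_eq_zero]
      · simp
      · intro b x _ hx hlen
        rw [ih l.length (by omega) l x (fun a ha b hb => h a (hx.subset ha) b (hx.subset hb))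
          (by omega) rfl, mul_zero]
      · intro b x _ _ hlen
        rw [ih x.length (by omega) x r h (by omega) rfl, mul_zero]

variable {M} {u v : ι}

/-- The only nonzero pairing inside the right block is `u` with `v`, so all of `r` would still have
to be matched with the shorter list `l`. -/
theorem pfaffian_eq_zero_of_almost_isotropic (l r : List ι)
    (hu : ∀ a ∈ u :: r, ∀ b ∈ u :: r, M (.inr a) (.inr b) = 0)
    (hv : ∀ a ∈ r ++ [v], ∀ b ∈ r ++ [v], M (.inr a) (.inr b) = 0) (hlt : l.length < r.length) :
    pfaffian M (l.map Sum.inl ++ (u :: (r ++ [v])).map Sum.inr) = 0 := by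
  induction hk : l.length using Nat.strong_induction_on generalizing l r with
  | _ k ih =>
    cases l with
    | nil =>
      have hz : pfaffian M (r.map Sum.inr) = 0 :=
        pfaffian_eq_zero_of_isotropic M [] r
          (fun a ha b hb => hu a (List.mem_cons_of_mem _ ha) b (List.mem_cons_of_mem _ hb)) hlt
      rw [List.map_nil, List.nil_append, pfaffian_inr_cons, altSum_append, altSum_cons, altSum_nil,
        List.append_nil, hz, altSum_eq_zero]
      · simp
      · intro b x hb _ _
        rw [hu u (by simp) b (by simp [hb]), zero_mul]
    | cons a l =>
      simp only [List.length_cons] at hk hlt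
      rw [pfaffian_inl_cons, altSum_cons, altSum_append, altSum_cons, altSum_nil, List.append_nil,
        pfaffian_eq_zero_of_isotropic M l (r ++ [v]) hv (by simp; omega),
        pfaffian_eq_zero_of_isotropic M l (u :: r) hu (by simp; omega), altSum_eq_zero,
        altSum_eq_zero]
      · simp
      · intro b x _ hx hlen
        rw [ih l.length (by omega) l x
          (fun a ha b hb => hu a ((hx.cons_cons u).subset ha) b ((hx.cons_cons u).subset hb))
          (fun a ha b hb => hv a ((hx.append_right [v]).subset ha) b
            ((hx.append_right [v]).subset hb)) (by omega) rfl, mul_zero]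
      · intro b x _ _ hlen
        rw [ih x.length (by omega) x r hu hv (by omega) rfl, mul_zero]

/-- The Pfaffian of a matrix whose lower right block has a single skew pair of entries, in the
corners. -/
theorem pfaffian_eq_listDet (l r : List ι)
    (hC : ∀ a b, M (.inl a) (.inr b) = - M (.inr b) (.inl a))
    (hu : ∀ a ∈ u :: r, ∀ b ∈ u :: r, M (.inr a) (.inr b) = 0)
    (hv : ∀ a ∈ r ++ [v], ∀ b ∈ r ++ [v], M (.inr a) (.inr b) = 0) (hlen : l.length = r.length) :
    pfaffian M (l.map Sum.inl ++ (u :: (r ++ [v])).map Sum.inr) =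
      (-1) ^ (l.length * (l.length - 1) / 2) * M (.inr u) (.inr v) *
        listDet (fun i j => M (.inr i) (.inl j)) r l := by
  induction l generalizing r with
  | nil =>
    obtain rfl := List.length_eq_zero_iff.1 hlen.symm
    rw [List.map_nil, List.nil_append, pfaffian_inr_cons]
    simp [altSum, listDet, pfaffian]
  | cons a l ih =>
    simp only [List.length_cons] at hlen
    rw [pfaffian_inl_cons, altSum_cons, altSum_append, altSum_cons, altSum_nil, List.append_nil,
      pfaffian_eq_zero_of_isotropic M l (r ++ [v]) hv (by simp; omega),
      pfaffian_eq_zero_of_isotropic M l (u :: r) hu (by simp; omega), altSum_eq_zero]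
    -- Only pairings of `a` with some `b` in `r` survive, and they form the expansion along the
    -- first column. The minus sign from passing `u` cancels the one from `hC`.
    · have hr : altSum (fun b y => M (.inl a) (.inr b) *
            pfaffian M (l.map Sum.inl ++ (u :: (y ++ [v])).map Sum.inr)) r =
          (-((-1) ^ (l.length * (l.length - 1) / 2) * M (.inr u) (.inr v))) *
            listDet (fun i j => M (.inr i) (.inl j)) r (a :: l) := by
        rw [listDet, ← altSum_mul_left]
        refine altSum_congr fun b x _ hx hxl => ?_
        rw [ih x
          (fun a ha b hb => hu a ((hx.cons_cons u).subset ha) b ((hx.cons_cons u).subset hb))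
          (fun a ha b hb => hv a ((hx.append_right [v]).subset ha) b
            ((hx.append_right [v]).subset hb)) (by omega), hC]
        ring
      -- Each step contributes `(-1) ^ l.length`, so the exponents add up to a triangular number.
      have hsign : (l.length + 1) * (l.length + 1 - 1) / 2 =
          l.length + l.length * (l.length - 1) / 2 := by
        rcases l.length with _ | k
        · rfl
        · simp only [Nat.add_sub_cancel]
          rw [show (k + 1 + 1) * (k + 1) = (k + 1) * k + (k + 1) * 2 by ring,
            Nat.add_mul_div_right _ _ two_pos, add_comm]
      rw [hr, List.length_cons, hsign, pow_add]
      ring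
    · intro b x _ _ hxl
      rw [pfaffian_eq_zero_of_almost_isotropic x r hu hv (by omega), mul_zero]

end Pfaffian

/-! ### Derivations of minors, and maps of Pfaffians -/

section Derivations

variable {k A : Type*} [CommRing k] [CommRing A] [Algebra k A]

theorem derivation_prod_eq_zero {β : Type*} (D : Derivation k A A) (s : Finset β) (f : β → A)
    (h : ∀ b ∈ s, D (f b) = 0) : D (∏ b ∈ s, f b) = 0 := by
  classical
  induction s using Finset.induction_on with
  | empty => simp
  | insert b s hb ih =>
    rw [Finset.prod_insert hb, D.leibniz, h b (by simp),
      ih fun c hc => h c (Finset.mem_insert_of_mem hc)]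
    simp

theorem derivation_det_eq_zero {m : Type*} [Fintype m] [DecidableEq m] (D : Derivation k A A)
    (M : Matrix m m A) (h : ∀ i j, D (M i j) = 0) : D M.det = 0 := by
  rw [Matrix.det_apply, map_sum]
  refine Finset.sum_eq_zero fun σ _ => ?_
  rcases Int.units_eq_one_or (Equiv.Perm.sign σ) with hσ | hσ <;>
    simp [hσ, derivation_prod_eq_zero D _ _ fun i _ => h (σ i) i]

/-- In the expansion along row `a` every minor is constant for `D`, and so is every entry except the
diagonal one. -/
theorem derivation_listMinor_cons {ι : Type*} (D : Derivation k A A) (M : ι → ι → A) (a : ι)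
    (l : List ι) (hrow : ∀ j ∈ l, D (M a j) = 0) (h : ∀ i ∈ l, ∀ j, D (M i j) = 0) :
    D (listMinor M (a :: l)) = D (M a a) * listMinor M l := by
  have hdet : listMinor M (a :: l) = _ := Matrix.det_succ_row_zero (n := l.length) _
  have hminor : ∀ f : Fin l.length → Fin (l.length + 1), D ((Matrix.submatrix (Matrix.of
      fun s t : Fin (a :: l).length => M ((a :: l).get s) ((a :: l).get t)) Fin.succ f).det) = 0 :=
    fun f => derivation_det_eq_zero D _ fun i j => h _ (List.get_mem l i) _
  have hsign : ∀ j : ℕ, D ((-1) ^ j) = 0 := fun j => by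
    rcases neg_one_pow_eq_or A j with hj | hj <;> simp [hj]
  rw [hdet, Fin.sum_univ_succ, map_add, map_sum, Finset.sum_eq_zero, add_zero]
  · rw [D.leibniz, hminor, smul_zero, zero_add, smul_eq_mul, mul_comm]
    congr 1
    simp
  · intro j _
    have hj : D (M a l[(j : ℕ)]) = 0 := hrow _ (List.getElem_mem _)
    rw [D.leibniz, hminor, D.leibniz, hsign]
    simp [hj]

theorem map_pfaffian {ι R S : Type*} [CommRing R] [CommRing S] (f : R →+* S) (M : ι → ι → R)
    (l : List ι) : f (pfaffian M l) = pfaffian (fun i j => f (M i j)) l := by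
  induction hk : l.length using Nat.strong_induction_on generalizing l with
  | _ k ih =>
    cases l with
    | nil => simp [pfaffian]
    | cons a l =>
      rw [pfaffian, pfaffian, map_sum]
      refine Finset.sum_congr rfl fun j _ => ?_
      have := List.length_eraseIdx_add_one j.isLt
      rw [List.length_cons] at hk
      rw [map_mul, map_mul, ih _ (by omega) _ rfl]
      simp

theorem map_listMinor {ι R S : Type*} [CommRing R] [CommRing S] (f : R →+* S) (M : ι → ι → R)
    (l : List ι) : f (listMinor M l) = listMinor (fun i j => f (M i j)) l := by
  unfold listMinor
  rw [RingHom.map_det]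
  rfl

/-- The commutator of the two is a derivation that vanishes on all variables. -/
theorem pderiv_pderiv_comm {σ R : Type*} [CommRing R] (v w : σ) (f : MvPolynomial σ R) :
    MvPolynomial.pderiv v (MvPolynomial.pderiv w f) =
      MvPolynomial.pderiv w (MvPolynomial.pderiv v f) := by
  classical
  have h : ⁅MvPolynomial.pderiv (R := R) v, MvPolynomial.pderiv (R := R) w⁆ = 0 := by
    refine MvPolynomial.derivation_ext (R := R) fun u => ?_
    simp only [Derivation.commutator_apply, MvPolynomial.pderiv_X, Pi.single_apply]
    split_ifs <;> simp
  have := DFunLike.congr_fun h f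
  simpa [Derivation.commutator_apply, sub_eq_zero] using this

end Derivations

/-! ### Reduction of the correlator to a minor of `Ã` -/

section Reduction

open MvPolynomial

variable {K : Type*} [Field K] {N : ℕ}

/-- The derivation `∂_{2 e_a · (p_b - p_n)}`. -/
noncomputable def scalarDeriv (a b : Fin (N + 2)) :
    Derivation K (MvPolynomial (PolVar (Fin (N + 2))) K) (MvPolynomial (PolVar (Fin (N + 2))) K) :=
  pderiv (.ep a b) - pderiv (.ep a (Fin.last (N + 1)))

theorem scalarDeriv_apply (a b : Fin (N + 2)) (f : MvPolynomial (PolVar (Fin (N + 2))) K) :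
    scalarDeriv a b f = pderiv (.ep a b) f - pderiv (.ep a (Fin.last (N + 1))) f := rfl

theorem insertScalars_cons (f : MvPolynomial (PolVar (Fin (N + 2))) K) (b a : Fin (N + 2))
    (l : List (Fin (N + 2))) :
    insertScalars f b (a :: l) = scalarDeriv a b (insertScalars f a l) := rfl

theorem scalarDeriv_comm (a b c d : Fin (N + 2)) (f : MvPolynomial (PolVar (Fin (N + 2))) K) :
    scalarDeriv a b (scalarDeriv c d f) = scalarDeriv c d (scalarDeriv a b f) := by
  simp only [scalarDeriv_apply, map_sub, pderiv_pderiv_comm (PolVar.ep a _)]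
  ring

theorem insertScalars_scalarDeriv (a b c : Fin (N + 2)) (l : List (Fin (N + 2)))
    (f : MvPolynomial (PolVar (Fin (N + 2))) K) :
    insertScalars (scalarDeriv a b f) c l = scalarDeriv a b (insertScalars f c l) := by
  induction l generalizing c with
  | nil => rfl
  | cons d l ih => rw [insertScalars_cons, insertScalars_cons, ih, scalarDeriv_comm]

theorem insertScalars_mul_of_const (g f : MvPolynomial (PolVar (Fin (N + 2))) K)
    (hg : ∀ a b, scalarDeriv a b g = 0) (c : Fin (N + 2)) (l : List (Fin (N + 2))) :
    insertScalars (g * f) c l = g * insertScalars f c l := by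
  induction l generalizing c with
  | nil => rfl
  | cons d l ih => simp [insertScalars_cons, ih, hg]

theorem scalarDeriv_C (a b : Fin (N + 2)) (c : K) :
    scalarDeriv a b (C c) = 0 := by
  simp

theorem scalarDeriv_ee (a b : Fin (N + 2)) (e : Sym2 (Fin (N + 2))) :
    scalarDeriv a b (X (.ee e) : MvPolynomial (PolVar (Fin (N + 2))) K) = 0 := by
  classical
  simp [scalarDeriv_apply, pderiv_X]

theorem scalarDeriv_ep (a b i j : Fin (N + 2)) :
    scalarDeriv a b (X (.ep i j) : MvPolynomial (PolVar (Fin (N + 2))) K) =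
      if i = a then (if j = b then 1 else 0) - (if j = Fin.last (N + 1) then 1 else 0) else 0 := by
  classical
  simp only [scalarDeriv_apply, pderiv_X, Pi.single_apply, PolVar.ep.injEq]
  by_cases h : i = a <;> simp [h]

variable (z : Fin (N + 2) → K)

theorem scalarDeriv_matC_of_ne {a i : Fin (N + 2)} (h : i ≠ a) (b j : Fin (N + 2)) :
    scalarDeriv a b (matC z i j) = 0 := by
  unfold matC
  split_ifs <;> simp [scalarDeriv_ep, h]

theorem scalarDeriv_matC_row {a b j : Fin (N + 2)} (hja : j ≠ a) (hjb : j ≠ b)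
    (hjn : j ≠ Fin.last (N + 1)) : scalarDeriv a b (matC z a j) = 0 := by
  rw [matC, if_neg hja.symm]
  simp [scalarDeriv_ep, hjb, hjn]

theorem scalarDeriv_matC_self (a b : Fin (N + 2)) :
    scalarDeriv a b (matC z a a) = C ((z a - z (Fin.last (N + 1)))⁻¹ - (z a - z b)⁻¹) := by
  rw [matC, if_pos rfl]
  simp [scalarDeriv_ep, mul_sub, Finset.sum_sub_distrib]

/-- The factor produced by the insertion of the colored scalars. -/
def insertionFactor (z : Fin (N + 2) → K) : Fin (N + 2) → List (Fin (N + 2)) → K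
  | _, [] => 1
  | b, a :: l => ((z a - z (Fin.last (N + 1)))⁻¹ - (z a - z b)⁻¹) * insertionFactor z a l

theorem insertScalars_listMinor (b : Fin (N + 2)) (α π : List (Fin (N + 2)))
    (hnd : (b :: (α ++ π) ++ [Fin.last (N + 1)]).Nodup) :
    insertScalars (listMinor (matC z) (α ++ π)) b α =
      C (insertionFactor z b α) * listMinor (matC z) π := by
  induction α generalizing b with
  | nil => simp [insertScalars, insertionFactor]
  | cons a α ih =>
    have hnd' : (a :: (α ++ π) ++ [Fin.last (N + 1)]).Nodup := (List.nodup_cons.1 hnd).2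
    have hb := (List.nodup_cons.1 hnd).1
    have ha := (List.nodup_cons.1 hnd').1
    have hlast : ∀ j ∈ a :: (α ++ π), j ≠ Fin.last (N + 1) := fun j hj =>
      (List.nodup_append.1 hnd').2.2 j hj _ (by simp)
    have hmem : ∀ j ∈ α ++ π, j ≠ a := fun j hj h =>
      ha (h ▸ List.mem_append_left [Fin.last (N + 1)] hj)
    have hmemb : ∀ j ∈ a :: (α ++ π), j ≠ b := fun j hj h =>
      hb (h ▸ List.mem_append_left [Fin.last (N + 1)] hj)
    -- The outermost derivative is made to act first. It sees row `a` off the diagonal only through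
    -- `p_b` and `p_n`, and neither `b` nor `n` labels a column: `b` is leg `1` or a scalar already
    -- stripped.
    rw [insertScalars_cons, ← insertScalars_scalarDeriv, List.cons_append,
      derivation_listMinor_cons, scalarDeriv_matC_self, insertScalars_mul_of_const, ih a hnd',
      insertionFactor, C_mul, mul_assoc]
    · exact fun _ _ => scalarDeriv_C _ _ _
    · exact fun j hj => scalarDeriv_matC_row z (hmem j hj) (hmemb j (List.mem_cons_of_mem _ hj))
        (hlast j (List.mem_cons_of_mem _ hj))
    · exact fun i hi j => scalarDeriv_matC_of_ne z (hmem i hi) b j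

theorem insertionFactor_mul_inv {z : Fin (N + 2) → K} (hz : Function.Injective z)
    (b : Fin (N + 2)) (α : List (Fin (N + 2))) (hnd : (b :: α ++ [Fin.last (N + 1)]).Nodup) :
    insertionFactor z b α * (z b - z (Fin.last (N + 1)))⁻¹ =
      pathWeight z b (α ++ [Fin.last (N + 1)]) := by
  induction α generalizing b with
  | nil => simp [insertionFactor, pathWeight]
  | cons a α ih =>
    have hnd' : (a :: α ++ [Fin.last (N + 1)]).Nodup := (List.nodup_cons.1 hnd).2
    have hlast : ∀ j ∈ b :: a :: α, z j - z (Fin.last (N + 1)) ≠ 0 := fun j hj =>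
      sub_ne_zero.2 (hz.ne ((List.nodup_append.1 hnd).2.2 j hj _ (by simp)))
    have hab : b ≠ a := fun h => (List.nodup_cons.1 hnd).1 (by simp [h])
    have h1 : z a - z b ≠ 0 := sub_ne_zero.2 (hz.ne hab.symm)
    have h2 : z b - z a ≠ 0 := sub_ne_zero.2 (hz.ne hab)
    have h3 := hlast a (by simp)
    have h4 := hlast b (by simp)
    -- Partial fractions trade `1/z_{bn}` for `1/z_{ba}` and pass `1/z_{an}` on to the next scalar,
    -- where the induction continues.
    have key : ((z a - z (Fin.last (N + 1)))⁻¹ - (z a - z b)⁻¹) *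
        (z b - z (Fin.last (N + 1)))⁻¹ = (z b - z a)⁻¹ * (z a - z (Fin.last (N + 1)))⁻¹ := by
      field_simp
      ring
    rw [insertionFactor, List.cons_append, pathWeight, ← ih a hnd', mul_right_comm, key]
    ring

/-- The substitution that kills every `2 e_i · e_j` except `2 e_1 · e_n`. -/
noncomputable def killPol :
    MvPolynomial (PolVar (Fin (N + 2))) K →ₐ[K] MvPolynomial (PolVar (Fin (N + 2))) K :=
  aeval fun
    | .ee e => if e = s(0, Fin.last (N + 1)) then X (.ee e) else 0
    | .ep a b => X (.ep a b)

theorem killPol_ee (e : Sym2 (Fin (N + 2))) :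
    killPol (X (.ee e) : MvPolynomial (PolVar (Fin (N + 2))) K) =
      if e = s(0, Fin.last (N + 1)) then X (.ee e) else 0 := by
  simp [killPol]

theorem killPol_ep (a b : Fin (N + 2)) :
    killPol (X (.ep a b) : MvPolynomial (PolVar (Fin (N + 2))) K) = X (.ep a b) := by
  simp [killPol]

theorem killPol_C (c : K) : killPol (N := N) (C c) = C c := by
  simp [killPol]

/-- `killPol` sends each variable to itself or to zero, so it creates no new dependence on a
variable that it fixes. -/
theorem pderiv_killPol (v : PolVar (Fin (N + 2))) (hv : killPol (K := K) (X v) = X v)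
    (f : MvPolynomial (PolVar (Fin (N + 2))) K) :
    pderiv v (killPol f) = killPol (pderiv v f) := by
  classical
  induction f using MvPolynomial.induction_on with
  | C c => simp
  | add f g hf hg => simp [hf, hg]
  | mul_X f w hf =>
    have hw : pderiv v (killPol (X w)) = killPol (K := K) (pderiv v (X w)) := by
      by_cases h : w = v
      · subst h
        rw [hv]
        simp
      · rw [pderiv_X_of_ne h, map_zero]
        cases w with
        | ee e =>
          rw [killPol_ee]
          split_ifs
          · exact pderiv_X_of_ne h
          · simp
        | ep a b => rw [killPol_ep, pderiv_X_of_ne h]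
    rw [map_mul, Derivation.leibniz, Derivation.leibniz, hf, hw]
    simp

theorem insertScalars_killPol (f : MvPolynomial (PolVar (Fin (N + 2))) K) (b : Fin (N + 2))
    (l : List (Fin (N + 2))) :
    insertScalars (killPol f) b l = killPol (insertScalars f b l) := by
  induction l generalizing b with
  | nil => rfl
  | cons a l ih =>
    rw [insertScalars_cons, insertScalars_cons, ih, scalarDeriv_apply, scalarDeriv_apply, map_sub,
      pderiv_killPol _ (killPol_ep _ _), pderiv_killPol _ (killPol_ep _ _)]

theorem killPol_matC (i j : Fin (N + 2)) : killPol (matC z i j) = matC z i j := by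
  unfold matC
  split_ifs <;> simp [killPol_ep]

theorem killPol_matB_eq_zero {i j : Fin (N + 2)} (h : s(i, j) ≠ s(0, Fin.last (N + 1))) :
    killPol (matB z i j) = 0 := by
  unfold matB
  split_ifs <;> simp [killPol_ee, h]

variable {W : Type*} [AddCommGroup W] [Module K W] (η : LinearMap.BilinForm K W)
  (p : Fin (N + 2) → W)

theorem eval_dimReduce_killPol (f : MvPolynomial (PolVar (Fin (N + 2))) K) :
    eval (dimReduce η p) (killPol f) = eval (dimReduce η p) f := by
  induction f using MvPolynomial.induction_on with
  | C c => rw [killPol_C]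
  | add f g hf hg => simp [hf, hg]
  | mul_X f w hf =>
    rw [map_mul, map_mul, map_mul, hf]
    congr 1
    cases w with
    | ee e =>
      rw [killPol_ee]
      split_ifs <;> simp [dimReduce]
    | ep a b => rw [killPol_ep]

/-- The labels `2, …, n - 1`. -/
def midLabels (N : ℕ) : List (Fin (N + 2)) :=
  ((List.finRange N).map Fin.castSucc).map Fin.succ

theorem finRange_eq_midLabels (N : ℕ) :
    List.finRange (N + 2) = 0 :: (midLabels N ++ [Fin.last (N + 1)]) := by
  rw [List.finRange_succ, List.finRange_succ_last]
  simp [midLabels]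

theorem nodup_midLabels (N : ℕ) : (0 :: (midLabels N ++ [Fin.last (N + 1)])).Nodup :=
  finRange_eq_midLabels N ▸ List.nodup_finRange _

theorem length_midLabels (N : ℕ) : (midLabels N).length = N := by
  simp [midLabels]

theorem mem_midLabels {N : ℕ} {i : Fin (N + 2)} (h : i ∈ midLabels N) :
    i ≠ 0 ∧ i ≠ Fin.last (N + 1) := by
  have hnd := nodup_midLabels N
  refine ⟨fun h0 => (List.nodup_cons.1 hnd).1 (h0 ▸ List.mem_append_left _ h), ?_⟩
  exact (List.nodup_append.1 (List.nodup_cons.1 hnd).2).2.2 i h _ (by simp)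

theorem psiIndices_empty (N : ℕ) : psiIndices (N := N) ∅ =
    (midLabels N).map Sum.inl ++ (0 :: (midLabels N ++ [Fin.last (N + 1)])).map Sum.inr := by
  have h : (midLabels N).filter (fun i => decide (i ≠ 0 ∧ i ≠ Fin.last (N + 1))) =
      midLabels N :=
    List.filter_eq_self.2 fun i hi => by simpa using mem_midLabels hi
  unfold psiIndices
  rw [finRange_eq_midLabels]
  simp only [Finset.notMem_empty, false_imp_iff, implies_true, and_true, decide_true,
    List.filter_true]
  rw [List.filter_cons_of_neg (by simp), List.filter_append, h,
    List.filter_cons_of_neg (by simp), List.filter_nil, List.append_nil]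

/-- A nonempty `ρ` carries a factor `2 e_i · e_j` whose pair avoids leg `1`, and this factor is
killed; the dependence on `α'` disappears with it. -/
theorem killPol_gaugeCorrelator (a' : K) : killPol (gaugeCorrelator η p z a') =
    C (z 0 - z (Fin.last (N + 1)))⁻¹ *
      pfaffian (fun i j => killPol (matPsi η p z i j)) (psiIndices ∅) := by
  unfold gaugeCorrelator
  rw [map_mul, killPol_C, map_sum, Finset.sum_eq_single ∅]
  · simp only [Finset.card_empty, pow_zero, inv_one, C_1, Finset.prod_empty, one_mul]
    exact congrArg _ (map_pfaffian killPol.toRingHom _ _)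
  · intro ρ hρ hne
    obtain ⟨e, he⟩ := Finset.nonempty_iff_ne_empty.2 hne
    have h0 : e ≠ s(0, Fin.last (N + 1)) := by
      rintro rfl
      exact (((Finset.mem_filter.1 hρ).2.1 _ he).2.1) (Sym2.mem_mk_left _ _)
    have hz : killPol (∏ e ∈ ρ, C (sqDiff z e)⁻¹ * X (.ee e)) = 0 := by
      rw [map_prod]
      refine Finset.prod_eq_zero he ?_
      rw [map_mul, killPol_ee, if_neg h0, mul_zero]
    rw [map_mul, map_mul, hz, mul_zero, zero_mul]
  · intro h
    exact absurd (by simp [pairings]) h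

theorem pfaffian_killPol_matPsi : pfaffian (fun i j => killPol (matPsi η p z i j)) (psiIndices ∅) =
    C ((-1) ^ (N * (N - 1) / 2) * (z 0 - z (Fin.last (N + 1)))⁻¹) *
      X (.ee s(0, Fin.last (N + 1))) * listMinor (matC z) (midLabels N) := by
  have h0 : (0 : Fin (N + 2)) ≠ Fin.last (N + 1) := Fin.last_pos.ne
  rw [psiIndices_empty, pfaffian_eq_listDet]
  · have hC : (fun i j => killPol (matPsi η p z (.inr i) (.inl j))) = matC z := by
      ext1 i
      ext1 j
      exact killPol_matC z i j
    have hB : killPol (matPsi η p z (.inr 0) (.inr (Fin.last (N + 1)))) =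
        C (z 0 - z (Fin.last (N + 1)))⁻¹ * X (.ee s(0, Fin.last (N + 1))) := by
      simp only [matPsi, matB, if_neg h0, map_mul, killPol_C, killPol_ee, if_true]
    rw [hC, hB, listDet_self, length_midLabels]
    simp [mul_assoc]
  · intro a b
    exact map_neg killPol _
  · intro a ha b hb
    have hne : ∀ c ∈ 0 :: midLabels N, c ≠ Fin.last (N + 1) := by
      intro c hc
      rcases List.mem_cons.1 hc with rfl | hc
      · exact h0
      · exact (mem_midLabels hc).2
    refine killPol_matB_eq_zero z ?_
    rw [Ne, Sym2.eq_iff]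
    rintro (h | h)
    · exact hne b hb h.2
    · exact hne a ha h.1
  · intro a ha b hb
    have hne : ∀ c ∈ midLabels N ++ [Fin.last (N + 1)], c ≠ 0 := by
      intro c hc
      rcases List.mem_append.1 hc with hc | hc
      · exact (mem_midLabels hc).1
      · rw [List.mem_singleton.1 hc]
        exact h0.symm
    refine killPol_matB_eq_zero z ?_
    rw [Ne, Sym2.eq_iff]
    rintro (h | h)
    · exact hne a ha h.1
    · exact hne b hb h.2
  · rfl

theorem eval_dimReduce_matC (i j : Fin (N + 2)) :
    eval (dimReduce η p) (matC z i j) = matATilde η p z i j := by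
  by_cases h : i = j
  · subst h
    simp [matC, matATilde, matA, funV, dimReduce, div_eq_inv_mul]
  · simp [matC, matATilde, matA, dimReduce, div_eq_inv_mul, h]

/-- After dimensional reduction the correlator is a minor of `Ã` times a Parke–Taylor factor. -/
theorem scalarColorCorrelator_eq_det (hz : Function.Injective z) (a' : K)
    (α π : List (Fin (N + 2)))
    (hlabels : (0 :: (α ++ π) ++ [Fin.last (N + 1)]).Perm (List.finRange (N + 2))) :
    scalarColorCorrelator η p z a' α = (-1) ^ ((N + 2) * (N + 1) / 2) *
      (listMinor (matATilde η p z) π * parkeTaylor z (0 :: α ++ [Fin.last (N + 1)])) := by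
  have hnd := hlabels.nodup_iff.2 (List.nodup_finRange _)
  have hperm : (midLabels N).Perm (α ++ π) := by
    rw [finRange_eq_midLabels] at hlabels
    exact ((List.perm_append_right_iff _).1 ((List.perm_cons _).1 hlabels)).symm
  have hmid : (midLabels N).Nodup :=
    (nodup_midLabels N).sublist ((List.sublist_append_left _ _).cons _)
  have hndα : (0 :: α ++ [Fin.last (N + 1)]).Nodup :=
    hnd.sublist (((List.sublist_append_left α π).cons_cons 0).append_right _)
  set c := (z 0 - z (Fin.last (N + 1)))⁻¹ with hc
  set e : PolVar (Fin (N + 2)) := .ee s(0, Fin.last (N + 1))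
  have hkill : killPol (gaugeCorrelator η p z a') =
      C (c * ((-1) ^ (N * (N - 1) / 2) * c)) * (X e * listMinor (matC z) (α ++ π)) := by
    rw [killPol_gaugeCorrelator, pfaffian_killPol_matPsi, listMinor_perm _ hmid hperm, ← hc,
      ← mul_assoc, ← mul_assoc, ← C_mul, mul_assoc (C _) (X _)]
  have hins : insertScalars (killPol (gaugeCorrelator η p z a')) 0 α =
      C (c * ((-1) ^ (N * (N - 1) / 2) * c)) *
        (X e * (C (insertionFactor z 0 α) * listMinor (matC z) π)) := by
    rw [hkill, insertScalars_mul_of_const _ _ fun _ _ => scalarDeriv_C _ _ _,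
      insertScalars_mul_of_const _ _ fun _ _ => scalarDeriv_ee _ _ _,
      insertScalars_listMinor z 0 α π hnd]
  have heval : scalarColorCorrelator η p z a' α =
      c * ((-1) ^ (N * (N - 1) / 2) * c) *
        (insertionFactor z 0 α * listMinor (matATilde η p z) π) := by
    have hmin : eval (dimReduce η p) (listMinor (matC z) π) = listMinor (matATilde η p z) π := by
      rw [map_listMinor]
      simp only [eval_dimReduce_matC]
    have he : dimReduce η p e = 0 := rfl
    rw [scalarColorCorrelator, gaugeColorCorrelator, ← eval_dimReduce_killPol,
      ← pderiv_killPol _ (by rw [killPol_ee, if_pos rfl]), ← insertScalars_killPol, hins,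
      pderiv_C_mul, Derivation.leibniz, pderiv_X_self]
    simp [hmin, he]
  -- One `c` comes from the prefactor of the correlator, the other from `B_{1n}`; the sign appears
  -- because the cycle closes with `1/z_{n1}`.
  have hPT : parkeTaylor z (0 :: α ++ [Fin.last (N + 1)]) = -(insertionFactor z 0 α * c * c) := by
    rw [parkeTaylor_eq_pathWeight, ← insertionFactor_mul_inv hz 0 α hndα, ← neg_sub (z 0), inv_neg,
      mul_neg]
  -- The exponents differ by the odd number `2 * N + 1`, which absorbs the sign in `hPT`.
  have hsign : (-1 : K) ^ ((N + 2) * (N + 1) / 2) = -(-1) ^ (N * (N - 1) / 2) := by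
    have : (N + 2) * (N + 1) / 2 = N * (N - 1) / 2 + (2 * N + 1) := by
      rcases N with _ | k
      · rfl
      · simp only [Nat.add_sub_cancel]
        rw [show (k + 1 + 2) * (k + 1 + 1) = (k + 1) * k + (2 * (k + 1) + 1) * 2 by ring,
          Nat.add_mul_div_right _ _ two_pos]
    rw [this, pow_add, pow_succ, pow_mul]
    simp
  rw [heval, hPT, hsign]
  ring

end Reduction

/-! ### Mandelstam sums -/

section Kinematics

variable {ι K W : Type*} [Field K] [AddCommGroup W] [Module K W]
  (η : LinearMap.BilinForm K W) (p : ι → W)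

theorem mandelstam_self {i : ι} (h : η (p i) (p i) = 0) : mandelstam η p i i = 0 := by
  rw [mandelstam, h, mul_zero]

theorem sum_mandelstam [Fintype ι] (hcons : ∑ i, p i = 0) (i : ι) :
    ∑ j, mandelstam η p i j = 0 := by
  simp only [mandelstam, ← Finset.mul_sum, ← map_sum, hcons, map_zero, mul_zero]

theorem mandelstamSum_eq_sum_map (i : ι) (l : List ι) :
    mandelstamSum η p i l = (l.map (mandelstam η p i)).sum := by
  induction l with
  | nil => simp [mandelstamSum]
  | cons a l ih =>
    rw [List.map_cons, List.sum_cons, ← ih]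
    simp [mandelstamSum, mandelstam, mul_add]

theorem mandelstamSum_eq_sum [Fintype ι] [DecidableEq ι] (i : ι) {l : List ι} (hl : l.Nodup) :
    mandelstamSum η p i l = ∑ x, if x ∈ l then mandelstam η p i x else 0 := by
  rw [mandelstamSum_eq_sum_map, ← List.sum_toFinset _ hl, ← Finset.sum_filter]
  congr 1
  ext x
  simp

end Kinematics

/-! ### From the minor of `Ã` to the logarithmic form -/

section Pions

variable {K W : Type*} [Field K] [AddCommGroup W] [Module K W]
  (η : LinearMap.BilinForm K W) {N : ℕ} (p : Fin (N + 2) → W) (z : Fin (N + 2) → K)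

/-- By momentum conservation `(z_i - z_n)⁻¹ ∑_x s_{ix} = 0` can be added to the diagonal, which
removes `s_{in}` from it. -/
theorem matATilde_eq_sum_edgeEntry (hshell : ∀ i, η (p i) (p i) = 0) (hcons : ∑ i, p i = 0)
    {i k : Fin (N + 2)} : matATilde η p z i k =
      ∑ x, mandelstam η p i x * edgeEntry z (Fin.last (N + 1)) x i k := by
  have hs := mandelstam_self η p (hshell i)
  by_cases h : i = k
  · subst h
    have hV : funV η p z i = ∑ x, mandelstam η p i x * (z i - z x)⁻¹ := by
      rw [funV, ← Finset.add_sum_erase _ _ (Finset.mem_univ i), hs, zero_mul, zero_add]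
      simp only [div_eq_mul_inv]
    have hz : ∑ x, mandelstam η p i x * (if i = x then (z i - z x)⁻¹ else 0) = 0 := by
      simp [hs]
    simp only [edgeEntry, if_true, mul_sub, Finset.sum_sub_distrib, hz, ← hV, ← Finset.sum_mul,
      sum_mandelstam η p hcons i]
    simp [matATilde, matA]
  · simp [matATilde, matA, edgeEntry, h, Ne.symm h, div_eq_mul_inv]

/-- The determinant form of the mixed correlator. -/
theorem listMinor_matATilde_mul_parkeTaylor (hshell : ∀ i, η (p i) (p i) = 0)
    (hcons : ∑ i, p i = 0) (hz : Function.Injective z) (α π : List (Fin (N + 2)))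
    (hlabels : (0 :: (α ++ π) ++ [Fin.last (N + 1)]).Perm (List.finRange (N + 2))) :
    listMinor (matATilde η p z) π * parkeTaylor z (0 :: α ++ [Fin.last (N + 1)]) =
      logarithmicForm η p z α π := by
  have hnd := hlabels.nodup_iff.2 (List.nodup_finRange _)
  have hM : (matATilde η p z : Fin (N + 2) → Fin (N + 2) → K) = fun i k =>
      ∑ x, mandelstam η p i x * edgeEntry z (Fin.last (N + 1)) x i k := by
    ext i k
    exact matATilde_eq_sum_edgeEntry η p z hshell hcons
  rw [hM, parkeTaylor_eq_pathWeight, ← mul_assoc,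
    listMinor_sum_edgeEntry_mul_pathWeight hz 0 _ α π _ (fun i => mandelstam_self η p (hshell i))
      (fun i => hlabels.mem_iff.2 (List.mem_finRange i)) hnd, mul_comm, ← interleaveSum_mul_left]
  refine interleaveSum_congr fun ρ hρ => ?_
  have hρnd : (0 :: ρ).Nodup :=
    (hρ.cons 0).nodup_iff.2 (hnd.sublist (List.sublist_append_left _ _))
  rw [parkeTaylor_eq_pathWeight, mul_comm, mul_assoc]
  congr 2
  exact List.map_congr_left fun i _ =>
    (mandelstamSum_eq_sum η p i (hρnd.sublist (List.take_sublist _ _))).symm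

theorem prod_mandelstamSum_eq_momentumKernel (hshell : ∀ i, η (p i) (p i) = 0)
    {π σ : List (Fin (N + 2))} (hσ : σ.Perm π) (hnd : (0 :: σ).Nodup) :
    (π.map fun i => mandelstamSum η p i (upTo (0 :: σ) i)).prod = momentumKernel η p σ σ := by
  have h0 := (List.nodup_cons.1 hnd).1
  have hσnd := (List.nodup_cons.1 hnd).2
  rw [← (hσ.map _).prod_eq, momentumKernel, ← List.prod_ofFn]
  conv_lhs => rw [← List.ofFn_get σ, List.map_ofFn]
  congr 2
  ext t
  have hidx : σ.idxOf (σ.get t) = t := hσnd.idxOf_getElem _ _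
  have hup : upTo (0 :: σ) (σ.get t) = 0 :: (σ.take t ++ [σ.get t]) := by
    rw [upTo_cons_of_ne fun h : 0 = σ.get t => h0 (h.symm ▸ List.get_mem σ t), upTo, hidx]
    simp
  have hfilter : (σ.take t).filter (fun b => σ.idxOf b < σ.idxOf (σ.get t)) = σ.take t := by
    refine List.filter_eq_self.2 fun b hb => ?_
    rw [hidx]
    simpa using (List.mem_take_iff_idxOf_lt (List.mem_of_mem_take hb)).1 hb
  -- `upTo` includes `σ_t` itself while the kernel uses strict predecessors; the extra term is
  -- `s_{ii} = 0`.
  have hs := mandelstam_self η p (hshell (σ.get t))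
  simp only [List.ofFn_get, Function.comp_apply, hup, hfilter, mandelstamSum_eq_sum_map]
  rw [List.map_cons, List.map_cons, List.map_append, List.sum_cons, List.sum_cons,
    List.sum_append, List.map_singleton, List.sum_singleton, hs, add_zero]

end Pions

end PionString

/-! ### Assembly of the three claims -/

theorem mainTheorem7 {K W : Type*} [Field K] [AddCommGroup W] [Module K W]
    (η : LinearMap.BilinForm K W) (hη : η.IsSymm) (N : ℕ)
    (p : Fin (N + 2) → W) (hshell : ∀ i, η (p i) (p i) = 0) (hcons : ∑ i, p i = 0)
    (z : Fin (N + 2) → K) (hz : Function.Injective z) (a' : K) (ha' : a' ≠ 0)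
    (α π : List (Fin (N + 2)))
    (hlabels : (0 :: (α ++ π) ++ [Fin.last (N + 1)]).Perm (List.finRange (N + 2))) :
    PionString.scalarColorCorrelator η p z a' α =
        (-1) ^ ((N + 2) * (N + 1) / 2) * PionString.logarithmicForm η p z α π ∧
      ((PionString.matATilde η p z).submatrix π.get π.get).det *
          PionString.parkeTaylor z (0 :: α ++ [Fin.last (N + 1)]) =
        PionString.logarithmicForm η p z α π ∧
      (α = [] →
        (∀ σ ∈ π.permutations,
          (π.map fun i => PionString.mandelstamSum η p i (PionString.upTo (0 :: σ) i)).prod =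
            PionString.momentumKernel η p σ σ) ∧
        PionString.scalarColorCorrelator η p z a' α =
          (-1) ^ ((N + 2) * (N + 1) / 2) * (π.permutations.map fun σ =>
            PionString.momentumKernel η p σ σ *
              PionString.parkeTaylor z (0 :: σ ++ [Fin.last (N + 1)])).sum) := by
  have hdet := PionString.listMinor_matATilde_mul_parkeTaylor η p z hshell hcons hz α π hlabels
  have hcor := PionString.scalarColorCorrelator_eq_det z η p hz a' α π hlabels
  rw [hdet] at hcor
  refine ⟨hcor, hdet, ?_⟩
  rintro rfl
  have hnd := hlabels.nodup_iff.2 (List.nodup_finRange _)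
  have hkernel : ∀ σ ∈ π.permutations,
      (π.map fun i => PionString.mandelstamSum η p i (PionString.upTo (0 :: σ) i)).prod =
        PionString.momentumKernel η p σ σ := fun σ hσ => by
    have hperm := List.mem_permutations.1 hσ
    exact PionString.prod_mandelstamSum_eq_momentumKernel η p hshell hperm
      ((hperm.cons 0).nodup_iff.2 (hnd.sublist (List.sublist_append_left _ _)))
  refine ⟨hkernel, ?_⟩
  rw [hcor, PionString.logarithmicForm]
  congr 2
  refine List.map_congr_left fun σ hσ => ?_
  rw [PionString.shuffle_nil_left, List.map_singleton, List.sum_singleton, hkernel σ hσ]
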